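/- Let $\mathbb{K}=\mathbb{R}$ or $\mathbb{C}$, let $\mu$ be a finite measure, and let $\mathbb{X}$ be a closed linear subspace of the space $L_1(\mu)$ of ($\mathbb{K}$-valued) integrable functions, with the norm of $L_1(\mu)$. Suppose that $\mathbb{X}$ is a GT-space, i.e. every bounded linear operator $T\colon\mathbb{X}\to\ell_2$ is absolutely summing: there is a constant $K$ with $$\sum_{i=1}^n\|T v_i\|\le K\,\sup\Big\{\sum_{i=1}^n|\varphi(v_i)| : \varphi\in\mathbb{X}^*,\ \|\varphi\|\le 1\Big\}\qquad\text{for all } n \text{ and } v_1,\dots,v_n\in\mathbb{X}.$$ Let $J$ be a countably infinite set with a fixed bijection $\tau\colon J\to\mathbb{N}$, and let $(\mathbf{x}_j)_{j\in J}$ be a quasi-greedy basis of $\mathbb{X}$. This means that the linear span of the $\mathbf{x}_j$ is dense in $\mathbb{X}$; that there are $\mathbf{x}_j^*\in\mathbb{X}^*$ with $\mathbf{x}_j^*(\mathbf{x}_k)=\delta_{jk}$; that $\sup_j\|\mathbf{x}_j\|\,\|\mathbf{x}_j^*\|<\infty$ and $0<\inf_j\|\mathbf{x}_j\|\le\sup_j\|\mathbf{x}_j\|<\infty$;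 and that for every $f\in\mathbb{X}$ $$\lim_{m\to\infty}\sum_{n=1}^m\mathbf{x}^*_{\rho(n)}(f)\,\mathbf{x}_{\rho(n)}=f \quad\text{in } \mathbb{X},$$ where $\rho\colon\mathbb{N}\to J$ is the greedy ordering for $f$, that is, the unique injective map whose range contains $\operatorname{supp}(f)=\{j:\mathbf{x}^*_j(f)\ne0\}$ and is all of $J$ if $\operatorname{supp}(f)$ is finite, such that $|\mathbf{x}^*_{\rho(k)}(f)|\ge|\mathbf{x}^*_{\rho(n)}(f)|$ for $k\le n$, and $\tau(\rho(k))\le\tau(\rho(n))$ whenever $k\le n$ and $|\mathbf{x}^*_{\rho(k)}(f)|=|\mathbf{x}^*_{\rho(n)}(f)|$. Then, for every $1<q\le\infty$, $$\limsup_{j\in J}\|\mathbf{x}_j\|_q=\infty,$$ where $\|\cdot\|_q$ is the $L_q(\mu)$-norm, with $\|f\|_q=\infty$ if $f\notin L_q(\mu)$, and the $\limsup$ is taken along the complements of the finite subsets of $J$. -/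

import Mathlib

open Filter Topology MeasureTheory
open scoped ENNReal

namespace QuasiGreedy

section Bases

variable {𝕜 : Type*} [RCLike 𝕜] {E : Type*} [NormedAddCommGroup E] [NormedSpace 𝕜 E]
  {J : Type*}

/-- `(x j, xs j)` is a biorthogonal system of `E`: the closed linear span of the `x j` is the
whole space, and `xs j (x k)` is `1` if `j = k` and `0` otherwise. -/
structure IsBiorthogonalSystem (x : J → E) (xs : J → StrongDual 𝕜 E) : Prop where
  closure_span : (Submodule.span 𝕜 (Set.range x)).topologicalClosure = ⊤
  apply_self : ∀ j, xs j (x j) = 1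
  apply_of_ne : ∀ j k, j ≠ k → xs j (x k) = 0

/-- The biorthogonal system is bounded: the supremum of `‖x j‖ * ‖xs j‖` is finite. -/
def IsBoundedSystem (x : J → E) (xs : J → StrongDual 𝕜 E) : Prop :=
  ∃ C : ℝ, ∀ j, ‖x j‖ * ‖xs j‖ ≤ C

/-- The norms of the `x j` are bounded above, and bounded below away from `0`. -/
def IsSemiNormalized (x : J → E) : Prop :=
  ∃ c C : ℝ, 0 < c ∧ ∀ j, c ≤ ‖x j‖ ∧ ‖x j‖ ≤ C

/-- The support of `f` with respect to the coordinate functionals `xs`. -/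
def coordSupport (xs : J → StrongDual 𝕜 E) (f : E) : Set J :=
  {j | xs j f ≠ 0}

/-- `ρ` is the greedy ordering for `f`, ties being broken by the enumeration `τ` of `J`. If the
coefficients of `f` tend to zero, then there is exactly one such `ρ`: it enumerates the support of
`f` if this is infinite, and all of `J` otherwise. -/
structure IsGreedyOrdering (τ : J ≃ ℕ) (xs : J → StrongDual 𝕜 E) (f : E) (ρ : ℕ → J) :
    Prop where
  injective : Function.Injective ρ
  support_subset : coordSupport xs f ⊆ Set.range ρ
  antitone : ∀ k n, k ≤ n → ‖xs (ρ n) f‖ ≤ ‖xs (ρ k) f‖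
  tie : ∀ k n, k ≤ n → ‖xs (ρ k) f‖ = ‖xs (ρ n) f‖ → τ (ρ k) ≤ τ (ρ n)
  range_of_finite : (coordSupport xs f).Finite → Set.range ρ = Set.univ

/-- The partial sum `∑_{n < m} xs (ρ n) f • x (ρ n)` of the expansion of `f` along `ρ`. For the
greedy ordering `ρ` of `f` it is the `m`-term greedy approximation of `f`. -/
noncomputable def partialSum (x : J → E) (xs : J → StrongDual 𝕜 E) (ρ : ℕ → J) (m : ℕ) (f : E) :
    E :=
  ∑ n ∈ Finset.range m, xs (ρ n) f • x (ρ n)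

/-- `x` is a quasi-greedy basis of `E` with orthogonal family `xs`: a semi-normalized bounded basis
such that for every `f` the greedy algorithm (with ties broken by `τ`) converges to `f`. -/
structure IsQuasiGreedyBasis (τ : J ≃ ℕ) (x : J → E) (xs : J → StrongDual 𝕜 E) : Prop where
  biorthogonal : IsBiorthogonalSystem x xs
  bounded : IsBoundedSystem x xs
  semiNormalized : IsSemiNormalized x
  tendsto_greedy : ∀ f : E, ∃ ρ : ℕ → J, IsGreedyOrdering τ xs f ρ ∧
    Tendsto (fun m => partialSum x xs ρ m f) atTop (𝓝 f)

end Bases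

section GT

variable {𝕜 : Type*} [RCLike 𝕜] {E : Type*} [NormedAddCommGroup E] [NormedSpace 𝕜 E]
  {F : Type*} [NormedAddCommGroup F] [NormedSpace 𝕜 F]

/-- `T` is absolutely summing (`1`-summing): for some constant `K`, all finite families `v` satisfy
`∑ i, ‖T (v i)‖ ≤ K * sup {∑ i, ‖φ (v i)‖ : φ ∈ E*, ‖φ‖ ≤ 1}`. The supremum is expressed by
its upper bounds `M`. -/
def IsAbsolutelySumming (T : E →L[𝕜] F) : Prop :=
  ∃ K : ℝ, 0 ≤ K ∧ ∀ (n : ℕ) (v : Fin n → E) (M : ℝ),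
    (∀ φ : StrongDual 𝕜 E, ‖φ‖ ≤ 1 → ∑ i, ‖φ (v i)‖ ≤ M) → ∑ i, ‖T (v i)‖ ≤ K * M

variable (𝕜 E) in
/-- `E` has the Grothendieck theorem property: every bounded linear operator from `E` into the
Hilbert space `ℓ₂` is absolutely summing. -/
def IsGTSpace : Prop :=
  ∀ T : E →L[𝕜] lp (fun _ : ℕ => 𝕜) 2, IsAbsolutelySumming T

end GT

end QuasiGreedy

/-!
The proof compares two growth rates of `‖∑_{j ∈ A} ± x j‖` in the cardinality `N` of `A`.

For `t > 0`, the threshold sum `∑_{|xs j f| ≥ t} xs j f • x j` is a greedy approximation of `f`. So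
the threshold sums of each `f` are bounded, and a Baire category argument makes the bound uniform
(`IsQuasiGreedyBasis.exists_thresholdSumsLE_mul_norm`). Hence the basis is unconditional for
constant coefficients (`norm_sum_smul_le_norm_sum_smul`, and `sum_norm_dual_apply_le` in dual form),
and coefficients may be truncated to the threshold (`mul_norm_sum_sign_le`).

*Lower bound.* By Khintchine's inequality `L₁` has cotype two, which together with truncation puts
the coefficients of every element of `X` in weak `ℓ₂` (`exists_mul_sqrt_card_le`). Multiplied by the
weights `(n + 1) ^ (-δ)`, with `δ > 0` arbitrarily small, they lie in `ℓ₂`, and define a bounded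
operator `T : X → ℓ₂` (`IsQuasiGreedyBasis.exists_weighted_coord_clm`). In a GT-space `T` is
absolutely summing. For the first `N` basis vectors from some rank on, `∑ ‖T (x j)‖` is of order at
least `N ^ (1 - δ)`, while the weak `ℓ₁` norm of these vectors is at most a constant times
`‖∑ ± x j‖`, for any choice of signs.

*Upper bound.* If the `limsup` is finite, then the `x j` are bounded in `L_r` for some `1 < r ≤ 2`,
outside a finite set of indices. Averaging over signs gives a choice with
`‖∑ ± x j‖₁ ≤ c * N ^ (1 / r)` (`exists_norm_sum_signOf_le`).

Taking `δ < 1 - 1 / r` gives a contradiction as `N` tends to infinity.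
-/

namespace QuasiGreedy

/-! ### Threshold sums are uniformly bounded -/

section Threshold

variable {𝕜 : Type*} [RCLike 𝕜] {E : Type*} [NormedAddCommGroup E] [NormedSpace 𝕜 E]
  {J : Type*} {x : J → E} {xs : J → StrongDual 𝕜 E}

/-- `A` is the set of indices at which the coefficient of `f` has modulus at least `t`. -/
def IsThresholdSet (xs : J → StrongDual 𝕜 E) (f : E) (t : ℝ) (A : Finset J) : Prop :=
  ∀ j, j ∈ A ↔ t ≤ ‖xs j f‖

/-- All threshold sums `∑_{|xs j f| ≥ t} xs j f • x j` of `f` with `t > 0` have norm at most `M`. -/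
def ThresholdSumsLE (x : J → E) (xs : J → StrongDual 𝕜 E) (f : E) (M : ℝ) : Prop :=
  ∀ (t : ℝ) (A : Finset J), 0 < t → IsThresholdSet xs f t A → ‖∑ j ∈ A, xs j f • x j‖ ≤ M

lemma IsQuasiGreedyBasis.exists_norm_coord_le {τ : J ≃ ℕ} (hx : IsQuasiGreedyBasis τ x xs) :
    ∃ C : ℝ, 0 < C ∧ ∀ j f, ‖xs j f‖ ≤ C * ‖f‖ := by
  obtain ⟨B, hB⟩ := hx.bounded
  obtain ⟨c, C, hc, hcC⟩ := hx.semiNormalized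
  refine ⟨|B| / c + 1, by positivity, fun j f => ?_⟩
  have h1 : ‖xs j‖ ≤ |B| / c := by
    rw [le_div_iff₀ hc]
    calc ‖xs j‖ * c ≤ ‖xs j‖ * ‖x j‖ := by gcongr; exact (hcC j).1
      _ = ‖x j‖ * ‖xs j‖ := mul_comm _ _
      _ ≤ |B| := (hB j).trans (le_abs_self B)
  calc ‖xs j f‖ ≤ ‖xs j‖ * ‖f‖ := (xs j).le_opNorm f
    _ ≤ (|B| / c + 1) * ‖f‖ := by gcongr; linarith

lemma IsBiorthogonalSystem.apply_eq (hx : IsBiorthogonalSystem x xs) [DecidableEq J] (j k : J) :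
    xs j (x k) = if j = k then 1 else 0 := by
  split_ifs with h
  · subst h; exact hx.apply_self j
  · exact hx.apply_of_ne j k h

lemma IsBiorthogonalSystem.apply_sum (hx : IsBiorthogonalSystem x xs) [DecidableEq J]
    (A : Finset J) (c : J → 𝕜) (j : J) :
    xs j (∑ k ∈ A, c k • x k) = if j ∈ A then c j else 0 := by
  simp [map_sum, hx.apply_eq]

lemma IsBiorthogonalSystem.exists_finset_of_mem_span (hx : IsBiorthogonalSystem x xs) {f : E}
    (hf : f ∈ Submodule.span 𝕜 (Set.range x)) : ∃ F : Finset J, ∀ j ∉ F, xs j f = 0 := by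
  classical
  induction hf using Submodule.span_induction with
  | mem y hy =>
    obtain ⟨k, rfl⟩ := hy
    exact ⟨{k}, fun j hj => hx.apply_of_ne j k (by simpa using hj)⟩
  | zero => exact ⟨∅, by simp⟩
  | add y z _ _ hy hz =>
    obtain ⟨F, hF⟩ := hy
    obtain ⟨G, hG⟩ := hz
    refine ⟨F ∪ G, fun j hj => ?_⟩
    simp only [Finset.mem_union, not_or] at hj
    simp [hF j hj.1, hG j hj.2]
  | smul a y _ hy =>
    obtain ⟨F, hF⟩ := hy
    exact ⟨F, fun j hj => by simp [hF j hj]⟩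

lemma IsBiorthogonalSystem.dense_span (hx : IsBiorthogonalSystem x xs) :
    Dense (Submodule.span 𝕜 (Set.range x) : Set E) :=
  (Submodule.dense_iff_topologicalClosure_eq_top).2 hx.closure_span

lemma IsBiorthogonalSystem.exists_isThresholdSet (hx : IsBiorthogonalSystem x xs) {C : ℝ}
    (hC : 0 < C) (hxs : ∀ j f, ‖xs j f‖ ≤ C * ‖f‖) (f : E) {t : ℝ} (ht : 0 < t) :
    ∃ A, IsThresholdSet xs f t A := by
  obtain ⟨g, hg, hfg⟩ := Metric.dense_iff.1 hx.dense_span f (t / C) (by positivity)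
  obtain ⟨F, hF⟩ := hx.exists_finset_of_mem_span hfg
  have hfin : {j | t ≤ ‖xs j f‖}.Finite := by
    refine F.finite_toSet.subset fun j hj => ?_
    by_contra hjF
    have h1 : ‖xs j (g - f)‖ < t := by
      calc ‖xs j (g - f)‖ ≤ C * ‖g - f‖ := hxs j _
        _ < C * (t / C) := by
          rw [mem_ball_iff_norm] at hg
          gcongr
        _ = t := by field_simp
    rw [map_sub, hF j hjF, zero_sub, norm_neg] at h1
    exact absurd hj (not_le.2 h1)
  exact ⟨hfin.toFinset, fun j => by simp⟩

/-- A threshold sum is one of the greedy sums, which converge and hence are bounded. -/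
lemma IsQuasiGreedyBasis.exists_thresholdSumsLE {τ : J ≃ ℕ} (hx : IsQuasiGreedyBasis τ x xs)
    (f : E) : ∃ N : ℕ, ThresholdSumsLE x xs f N := by
  classical
  obtain ⟨ρ, hρ, hlim⟩ := hx.tendsto_greedy f
  obtain ⟨R, hR⟩ := hlim.norm.bddAbove_range
  obtain ⟨N, hN⟩ := exists_nat_ge R
  refine ⟨N, fun t A ht hA => ?_⟩
  have hsub : ∀ j ∈ A, ∃ n, ρ n = j := fun j hj => hρ.support_subset <| by
    have := (hA j).1 hj
    exact norm_pos_iff.1 (ht.trans_le this)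
  let B : Finset ℕ := A.preimage ρ hρ.injective.injOn
  have hBA : B.image ρ = A := by
    ext j
    simp only [B, Finset.mem_image, Finset.mem_preimage]
    constructor
    · rintro ⟨n, hn, rfl⟩; exact hn
    · intro hj
      obtain ⟨n, rfl⟩ := hsub j hj
      exact ⟨n, hj, rfl⟩
  have hlow : ∀ n ∈ B, ∀ k ≤ n, k ∈ B := by
    intro n hn k hk
    rw [Finset.mem_preimage, hA] at hn ⊢
    exact hn.trans (hρ.antitone k n hk)
  have hBr : B = Finset.range B.card := by
    refine Finset.eq_of_subset_of_card_le (fun n hn => ?_) (by simp)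
    have : Finset.range (n + 1) ⊆ B := fun k hk =>
      hlow n hn k (Nat.lt_succ_iff.1 (Finset.mem_range.1 hk))
    have := Finset.card_le_card this
    rw [Finset.card_range] at this
    exact Finset.mem_range.2 this
  have hsum : ∑ j ∈ A, xs j f • x j = partialSum x xs ρ B.card f := by
    rw [partialSum, ← hBr, ← hBA, Finset.sum_image hρ.injective.injOn]
  rw [hsum]
  exact (hR ⟨_, rfl⟩).trans hN

/-- Lowering the threshold slightly does not change the threshold set of `f`, and makes it stable
under small perturbations of `f`; so bounds for threshold sums pass to the limit. -/
lemma isClosed_setOf_thresholdSumsLE (hx : IsBiorthogonalSystem x xs) {C : ℝ}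
    (hC : 0 < C) (hxs : ∀ j f, ‖xs j f‖ ≤ C * ‖f‖) (M : ℝ) :
    IsClosed {f | ThresholdSumsLE x xs f M} := by
  refine isClosed_of_closure_subset fun f hf t A ht hA => ?_
  obtain ⟨A', hA'⟩ := hx.exists_isThresholdSet hC hxs f (half_pos ht)
  obtain ⟨s, hs, hst, hsA⟩ : ∃ s, t / 2 < s ∧ s < t ∧ ∀ j ∈ A', j ∉ A → ‖xs j f‖ < s := by
    have h1 : ∀ᶠ s in 𝓝[<] t, ∀ j ∈ A', j ∉ A → ‖xs j f‖ < s := by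
      rw [eventually_all_finset]
      intro j _
      by_cases hj : j ∈ A
      · simp [hj]
      · rw [hA, not_le] at hj
        filter_upwards [mem_nhdsWithin_of_mem_nhds (lt_mem_nhds hj)] with s hs _ using hs
    have h2 : ∀ᶠ s in 𝓝[<] t, t / 2 < s :=
      mem_nhdsWithin_of_mem_nhds (lt_mem_nhds (half_lt_self ht))
    have h3 : ∀ᶠ s in 𝓝[<] t, s < t := self_mem_nhdsWithin
    obtain ⟨s, h, hs, hst⟩ := (h1.and (h2.and h3)).exists
    exact ⟨s, hs, hst, h⟩
  have hoff : ∀ j ∉ A, ‖xs j f‖ < s := by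
    intro j hj
    by_cases hj' : j ∈ A'
    · exact hsA j hj' hj
    · rw [hA', not_le] at hj'
      exact hj'.trans hs
  by_contra! hlt
  have hcont : Continuous fun g : E => ‖∑ j ∈ A, xs j g • x j‖ := by fun_prop
  have hnhds : ∀ᶠ g in 𝓝 f, M < ‖∑ j ∈ A, xs j g • x j‖ :=
    hcont.continuousAt.eventually (lt_mem_nhds hlt)
  have hball : ∀ᶠ g in 𝓝 f, ‖g - f‖ < (t - s) / (2 * C) := by
    have : 0 < (t - s) / (2 * C) := div_pos (by linarith) (by positivity)
    filter_upwards [Metric.ball_mem_nhds f this] with g hg using mem_ball_iff_norm.1 hg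
  obtain ⟨g, ⟨hg1, hg2⟩, hg3⟩ := (mem_closure_iff_nhds.1 hf _ (hnhds.and hball))
  refine absurd (hg3 ((t + s) / 2) A (by linarith) fun j => ?_) (not_le.2 hg1)
  have hd : ‖xs j g - xs j f‖ < (t - s) / 2 := by
    rw [← map_sub]
    calc ‖xs j (g - f)‖ ≤ C * ‖g - f‖ := hxs j _
      _ < C * ((t - s) / (2 * C)) := by gcongr
      _ = (t - s) / 2 := by field_simp
  have hd' := abs_lt.1 ((abs_norm_sub_norm_le _ _).trans_lt hd)
  constructor
  · intro hj
    have := (hA j).1 hj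
    linarith [hd'.1]
  · intro hj
    by_contra hjA
    have := hoff j hjA
    linarith [hd'.2]

/-- The nonlinear uniform boundedness principle for the greedy algorithm: threshold sums are
uniformly bounded. By Baire, they are bounded on a ball about some finitely supported `f₀`; an
arbitrary `f`, rescaled and with its coefficients on the support of `f₀` removed, is moved into this
ball by adding `f₀`, without interference of the coefficients. -/
theorem IsQuasiGreedyBasis.exists_thresholdSumsLE_mul_norm [CompleteSpace E] {τ : J ≃ ℕ}
    (hx : IsQuasiGreedyBasis τ x xs) :
    ∃ C : ℝ, 1 ≤ C ∧ ∀ f, ThresholdSumsLE x xs f (C * ‖f‖) := by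
  classical
  obtain ⟨K, hK, hxs⟩ := hx.exists_norm_coord_le
  obtain ⟨N, f₁, hf₁⟩ := nonempty_interior_of_iUnion_of_closed
    (fun N : ℕ => isClosed_setOf_thresholdSumsLE hx.biorthogonal hK hxs (N : ℝ))
    (Set.eq_univ_of_forall fun f => Set.mem_iUnion.2 (hx.exists_thresholdSumsLE f))
  obtain ⟨f₀, hf₀, hspan⟩ :=
    hx.biorthogonal.dense_span.inter_open_nonempty _ isOpen_interior ⟨f₁, hf₁⟩
  obtain ⟨r, hr, hball⟩ := Metric.isOpen_iff.1 isOpen_interior f₀ hf₀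
  obtain ⟨F, hF⟩ := hx.biorthogonal.exists_finset_of_mem_span hspan
  set CF : ℝ := ∑ j ∈ F, ‖xs j‖ * ‖x j‖ with hCF
  have hCF0 : 0 ≤ CF := Finset.sum_nonneg fun j _ => by positivity
  have hP : ∀ (f : E) (G : Finset J), G ⊆ F → ‖∑ j ∈ G, xs j f • x j‖ ≤ CF * ‖f‖ := by
    intro f G hG
    calc ‖∑ j ∈ G, xs j f • x j‖ ≤ ∑ j ∈ G, ‖xs j‖ * ‖x j‖ * ‖f‖ := by
          refine norm_sum_le_of_le _ fun j _ => ?_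
          rw [norm_smul]
          calc ‖xs j f‖ * ‖x j‖ ≤ ‖xs j‖ * ‖f‖ * ‖x j‖ := by gcongr; exact (xs j).le_opNorm f
            _ = _ := by ring
      _ ≤ ∑ j ∈ F, ‖xs j‖ * ‖x j‖ * ‖f‖ :=
          Finset.sum_le_sum_of_subset_of_nonneg hG fun _ _ _ => by positivity
      _ = CF * ‖f‖ := by rw [hCF, Finset.sum_mul]
  refine ⟨1 + CF + (N + CF * ‖f₀‖) * (2 * (1 + CF) / r), ?_, fun f t A ht hA => ?_⟩
  · have : 0 ≤ (N + CF * ‖f₀‖) * (2 * (1 + CF) / r) := by positivity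
    linarith
  rcases eq_or_ne f 0 with rfl | hf
  · simp
  have hfpos : 0 < ‖f‖ := norm_pos_iff.2 hf
  set l : ℝ := r / (2 * (1 + CF) * ‖f‖) with hl
  have hlpos : 0 < l := by positivity
  set g : E := f - ∑ j ∈ F, xs j f • x j with hg
  have hgn : ‖g‖ ≤ (1 + CF) * ‖f‖ := by
    calc ‖g‖ ≤ ‖f‖ + ‖∑ j ∈ F, xs j f • x j‖ := norm_sub_le _ _
      _ ≤ ‖f‖ + CF * ‖f‖ := by gcongr; exact hP f F subset_rfl
      _ = _ := by ring
  have hcoord : ∀ j, xs j (f₀ + (l : 𝕜) • g) = if j ∈ F then xs j f₀ else (l : 𝕜) * xs j f := by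
    intro j
    rw [hg, map_add, map_smul, map_sub, hx.biorthogonal.apply_sum]
    split_ifs with h
    · simp
    · simp [hF j h]
  have hmem : ThresholdSumsLE x xs (f₀ + (l : 𝕜) • g) N := by
    refine interior_subset (hball ?_)
    rw [mem_ball_iff_norm, add_sub_cancel_left, norm_smul, RCLike.norm_ofReal, abs_of_pos hlpos]
    calc l * ‖g‖ ≤ l * ((1 + CF) * ‖f‖) := by gcongr
      _ = r / 2 := by rw [hl]; field_simp
      _ < r := half_lt_self hr
  have hB := hmem (l * t) (A \ F ∪ F.filter fun j => l * t ≤ ‖xs j f₀‖) (by positivity) (by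
    intro j
    rw [hcoord]
    by_cases hj : j ∈ F
    · simp [hj]
    · simp only [Finset.mem_union, Finset.mem_sdiff, hj, hA j, Finset.mem_filter, if_false,
        not_false_eq_true, and_true, false_and, or_false, norm_mul, RCLike.norm_ofReal,
        abs_of_pos hlpos]
      rw [mul_le_mul_iff_right₀ hlpos])
  rw [Finset.sum_union] at hB
  swap
  · rw [Finset.disjoint_left]
    intro j hj hj'
    exact (Finset.mem_sdiff.1 hj).2 (Finset.mem_filter.1 hj').1
  have hs1 : ∑ j ∈ A \ F, xs j (f₀ + (l : 𝕜) • g) • x j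
      = (l : 𝕜) • ∑ j ∈ A \ F, xs j f • x j := by
    rw [Finset.smul_sum]
    refine Finset.sum_congr rfl fun j hj => ?_
    rw [hcoord, if_neg (Finset.mem_sdiff.1 hj).2, mul_smul]
  have hs2 : ∑ j ∈ F.filter (fun j => l * t ≤ ‖xs j f₀‖), xs j (f₀ + (l : 𝕜) • g) • x j
      = ∑ j ∈ F.filter (fun j => l * t ≤ ‖xs j f₀‖), xs j f₀ • x j := by
    refine Finset.sum_congr rfl fun j hj => ?_
    rw [hcoord, if_pos (Finset.mem_filter.1 hj).1]
  rw [hs1, hs2] at hB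
  have h1 : l * ‖∑ j ∈ A \ F, xs j f • x j‖ ≤ N + CF * ‖f₀‖ := by
    have h2 := hP f₀ (F.filter fun j => l * t ≤ ‖xs j f₀‖) (Finset.filter_subset _ _)
    have h3 := norm_sub_le_norm_add ((l : 𝕜) • ∑ j ∈ A \ F, xs j f • x j)
      (∑ j ∈ F.filter (fun j => l * t ≤ ‖xs j f₀‖), xs j f₀ • x j)
    rw [norm_smul, RCLike.norm_ofReal, abs_of_pos hlpos] at h3
    linarith
  have h2 : ‖∑ j ∈ A \ F, xs j f • x j‖ ≤ (N + CF * ‖f₀‖) * (2 * (1 + CF) / r) * ‖f‖ := by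
    calc ‖∑ j ∈ A \ F, xs j f • x j‖ = l * ‖∑ j ∈ A \ F, xs j f • x j‖ * l⁻¹ := by field_simp
      _ ≤ (N + CF * ‖f₀‖) * l⁻¹ := by gcongr
      _ = _ := by rw [hl]; field_simp
  have h3 := hP f (A ∩ F) Finset.inter_subset_right
  calc ‖∑ j ∈ A, xs j f • x j‖
      = ‖∑ j ∈ A ∩ F, xs j f • x j + ∑ j ∈ A \ F, xs j f • x j‖ := by
        rw [Finset.sum_inter_add_sum_sdiff]
    _ ≤ CF * ‖f‖ + (N + CF * ‖f₀‖) * (2 * (1 + CF) / r) * ‖f‖ :=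
        (norm_add_le _ _).trans (add_le_add h3 h2)
    _ ≤ _ := by nlinarith

end Threshold

/-! ### Truncation, and unconditionality for constant coefficients -/

section Multipliers

variable {𝕜 : Type*} [RCLike 𝕜] {E : Type*} [NormedAddCommGroup E] [NormedSpace 𝕜 E]
  {J : Type*} {x : J → E} {xs : J → StrongDual 𝕜 E}

/-- Multipliers `g j ∈ [0, 1]` average the indicators of their superlevel sets:
`g j = ∫₀¹ 1_{s ≤ g j} ds`. -/
lemma norm_sum_smul_le_of_superlevel {J : Type*} (A : Finset J) (g : J → ℝ) (v : J → 𝕜) {M : ℝ}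
    (hg0 : ∀ j ∈ A, 0 ≤ g j) (hg1 : ∀ j ∈ A, g j ≤ 1)
    (h : ∀ s, 0 < s → s ≤ 1 → ‖∑ j ∈ A with s ≤ g j, v j‖ ≤ M) :
    ‖∑ j ∈ A, g j • v j‖ ≤ M := by
  have hint : ∀ j ∈ A, ∫ s in Set.Ioc (0 : ℝ) 1, (Set.Iic (g j)).indicator (fun _ => v j) s
      = g j • v j := by
    intro j hj
    rw [integral_indicator measurableSet_Iic, Measure.restrict_restrict measurableSet_Iic,
      setIntegral_const, Set.inter_comm, Set.Ioc_inter_Iic, min_eq_right (hg1 j hj),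
      Real.volume_real_Ioc_of_le (hg0 j hj), sub_zero]
  rw [← Finset.sum_congr rfl hint, ← integral_finsetSum]
  · have hb := norm_setIntegral_le_of_norm_le_const (μ := volume) (s := Set.Ioc (0 : ℝ) 1)
      (f := fun s => ∑ j ∈ A, (Set.Iic (g j)).indicator (fun _ => v j) s) (C := M) (by simp)
      (fun s hs => by
        simpa [Finset.sum_filter, Set.indicator_apply] using h s hs.1 hs.2)
    simpa using hb
  · intro j _
    exact (integrable_const (v j)).indicator measurableSet_Iic

/-- Truncating the coefficients on a threshold set to the threshold keeps the sum under control. -/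
lemma mul_norm_sum_sign_le {C : ℝ} (hC : 0 ≤ C)
    (hxC : ∀ f, ThresholdSumsLE x xs f (C * ‖f‖)) {f : E} {t : ℝ} (ht : 0 < t) {A : Finset J}
    (hA : IsThresholdSet xs f t A) :
    t * ‖∑ j ∈ A, (xs j f / (‖xs j f‖ : 𝕜)) • x j‖ ≤ 2 * (C * ‖f‖) := by
  obtain ⟨φ, hφ, hφx⟩ :=
    exists_dual_vector'' 𝕜 (∑ j ∈ A, (xs j f / (‖xs j f‖ : 𝕜)) • x j)
  have hpos : ∀ j ∈ A, 0 < ‖xs j f‖ := fun j hj => ht.trans_le ((hA j).1 hj)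
  have hφle : ∀ y, ‖φ y‖ ≤ ‖y‖ := fun y =>
    (φ.le_opNorm y).trans (mul_le_of_le_one_left (norm_nonneg _) hφ)
  -- `t / |a| = 1 - g` where `g = 1 - t / |a|` increases with `|a|`
  have h1 : ‖∑ j ∈ A, (1 - t / ‖xs j f‖) • φ (xs j f • x j)‖ ≤ C * ‖f‖ := by
    refine norm_sum_smul_le_of_superlevel A _ _ (fun j hj => ?_) (fun j hj => ?_)
      fun s hs hs1 => ?_
    · rw [sub_nonneg, div_le_one (hpos j hj)]
      exact (hA j).1 hj
    · have := hpos j hj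
      have : 0 < t / ‖xs j f‖ := by positivity
      linarith
    · rcases hs1.eq_or_lt with rfl | hs1
      · rw [Finset.filter_false_of_mem, Finset.sum_empty, norm_zero]
        · positivity
        · intro j hj
          have := hpos j hj
          have : 0 < t / ‖xs j f‖ := by positivity
          linarith
      · rw [← map_sum]
        refine (hφle _).trans (hxC f (t / (1 - s)) _ (div_pos ht (by linarith)) fun j => ?_)
        have hs' : 0 < 1 - s := by linarith
        rw [Finset.mem_filter, div_le_iff₀ hs']
        constructor
        · rintro ⟨hj, h⟩
          have h' : t / ‖xs j f‖ ≤ 1 - s := by linarith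
          rw [div_le_iff₀ (hpos j hj)] at h'
          linarith
        · intro h
          have hj : j ∈ A := by
            rw [hA]
            nlinarith [norm_nonneg (xs j f)]
          refine ⟨hj, ?_⟩
          have h' : t / ‖xs j f‖ ≤ 1 - s := by
            rw [div_le_iff₀ (hpos j hj)]
            linarith
          linarith
  have h2 : ‖φ (∑ j ∈ A, xs j f • x j)‖ ≤ C * ‖f‖ := (hφle _).trans (hxC f t A ht hA)
  have h3 : (t : 𝕜) * φ (∑ j ∈ A, (xs j f / (‖xs j f‖ : 𝕜)) • x j)
      = φ (∑ j ∈ A, xs j f • x j) - ∑ j ∈ A, (1 - t / ‖xs j f‖) • φ (xs j f • x j) := by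
    rw [map_sum, map_sum, ← Finset.sum_sub_distrib, Finset.mul_sum]
    refine Finset.sum_congr rfl fun j _ => ?_
    rw [map_smul, map_smul, RCLike.real_smul_eq_coe_mul]
    simp only [smul_eq_mul]
    push_cast
    ring
  calc t * ‖∑ j ∈ A, (xs j f / (‖xs j f‖ : 𝕜)) • x j‖
      = ‖(t : 𝕜) * φ (∑ j ∈ A, (xs j f / (‖xs j f‖ : 𝕜)) • x j)‖ := by
        rw [hφx, norm_mul, RCLike.norm_ofReal, RCLike.norm_ofReal, abs_of_pos ht, abs_norm]
    _ ≤ C * ‖f‖ + C * ‖f‖ := by rw [h3]; exact (norm_sub_le _ _).trans (add_le_add h2 h1)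
    _ = _ := by ring

/-- Sums with unimodular coefficients dominate their subsums: increasing the coefficients on `B` a
little turns `B` into a threshold set. -/
lemma norm_sum_subset_le (hx : IsBiorthogonalSystem x xs) {C : ℝ} (hC : 1 ≤ C)
    (hxC : ∀ f, ThresholdSumsLE x xs f (C * ‖f‖)) {A B : Finset J} (hBA : B ⊆ A) {d : J → 𝕜}
    (hd : ∀ j ∈ A, ‖d j‖ = 1) :
    ‖∑ j ∈ B, d j • x j‖ ≤ 2 * C * ‖∑ j ∈ A, d j • x j‖ := by
  classical
  set r : ℝ := 1 / (2 * C) with hr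
  have hrpos : 0 < r := by positivity
  have hrC : C * r = 1 / 2 := by rw [hr]; field_simp
  set f : E := ∑ j ∈ A, ((if j ∈ B then ((1 + r : ℝ) : 𝕜) else 1) * d j) • x j with hf
  have hcoord : ∀ j, xs j f = if j ∈ A then (if j ∈ B then ((1 + r : ℝ) : 𝕜) else 1) * d j else 0 :=
    fun j => hx.apply_sum A _ j
  have hfeq : f = ∑ j ∈ A, d j • x j + (r : 𝕜) • ∑ j ∈ B, d j • x j := by
    rw [Finset.smul_sum, hf, ← Finset.inter_eq_right.2 hBA, ← Finset.sum_ite_mem,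
      ← Finset.sum_add_distrib]
    refine Finset.sum_congr rfl fun j hj => ?_
    simp only [Finset.mem_inter, hj, true_and]
    split_ifs with h
    · push_cast
      rw [add_mul, one_mul, add_smul, mul_smul]
    · simp
  have hfn : ‖f‖ ≤ ‖∑ j ∈ A, d j • x j‖ + r * ‖∑ j ∈ B, d j • x j‖ := by
    rw [hfeq]
    refine (norm_add_le _ _).trans_eq ?_
    rw [norm_smul, RCLike.norm_ofReal, abs_of_pos hrpos]
  have hr1 : ‖((1 + r : ℝ) : 𝕜)‖ = 1 + r := by
    rw [RCLike.norm_ofReal, abs_of_pos (by linarith)]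
  have hB : ‖∑ j ∈ B, xs j f • x j‖ ≤ C * ‖f‖ := by
    refine hxC f (1 + r) B (by linarith) fun j => ?_
    rw [hcoord]
    by_cases hj : j ∈ A
    · by_cases hjB : j ∈ B
      · rw [if_pos hj, if_pos hjB, norm_mul, hr1, hd j hj]
        simp [hjB]
      · simp [hj, hjB, hd j hj, hrpos]
    · have : j ∉ B := fun h => hj (hBA h)
      simp only [hj, this, if_false, norm_zero, false_iff, not_le]
      linarith
  have hBs : ∑ j ∈ B, xs j f • x j = ((1 + r : ℝ) : 𝕜) • ∑ j ∈ B, d j • x j := by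
    rw [Finset.smul_sum]
    refine Finset.sum_congr rfl fun j hj => ?_
    rw [hcoord, if_pos (hBA hj), if_pos hj, mul_smul]
  rw [hBs, norm_smul, hr1] at hB
  have h1 : C * ‖f‖ ≤ C * ‖∑ j ∈ A, d j • x j‖ + 1 / 2 * ‖∑ j ∈ B, d j • x j‖ := by
    calc C * ‖f‖ ≤ C * (‖∑ j ∈ A, d j • x j‖ + r * ‖∑ j ∈ B, d j • x j‖) := by gcongr
      _ = C * ‖∑ j ∈ A, d j • x j‖ + C * r * ‖∑ j ∈ B, d j • x j‖ := by ring
      _ = _ := by rw [hrC]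
  nlinarith [norm_nonneg (∑ j ∈ B, d j • x j)]

lemma sum_abs_le_of_forall_subset {J : Type*} {A : Finset J} {r : J → ℝ} {M : ℝ}
    (h : ∀ B ⊆ A, |∑ j ∈ B, r j| ≤ M) : ∑ j ∈ A, |r j| ≤ 2 * M := by
  rw [← Finset.sum_filter_add_sum_filter_not A (fun j => 0 ≤ r j)]
  have h1 : ∑ j ∈ A with 0 ≤ r j, |r j| = ∑ j ∈ A with 0 ≤ r j, r j :=
    Finset.sum_congr rfl fun j hj => abs_of_nonneg (Finset.mem_filter.1 hj).2
  have h2 : ∑ j ∈ A with ¬ 0 ≤ r j, |r j| = -∑ j ∈ A with ¬ 0 ≤ r j, r j := by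
    rw [← Finset.sum_neg_distrib]
    exact Finset.sum_congr rfl fun j hj => abs_of_neg (not_le.1 (Finset.mem_filter.1 hj).2)
  rw [h1, h2]
  have h3 := (le_abs_self _).trans (h _ (Finset.filter_subset (fun j => 0 ≤ r j) A))
  have h4 := (neg_le_abs _).trans (h _ (Finset.filter_subset (fun j => ¬ 0 ≤ r j) A))
  linarith

lemma sum_norm_le_of_forall_subset {J : Type*} {A : Finset J} {z : J → 𝕜} {M : ℝ}
    (h : ∀ B ⊆ A, ‖∑ j ∈ B, z j‖ ≤ M) : ∑ j ∈ A, ‖z j‖ ≤ 4 * M := by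
  have h1 : ∑ j ∈ A, |RCLike.re (z j)| ≤ 2 * M := sum_abs_le_of_forall_subset fun B hB => by
    rw [← map_sum]
    exact (RCLike.abs_re_le_norm _).trans (h B hB)
  have h2 : ∑ j ∈ A, |RCLike.im (z j)| ≤ 2 * M := sum_abs_le_of_forall_subset fun B hB => by
    rw [← map_sum]
    exact (RCLike.abs_im_le_norm _).trans (h B hB)
  calc ∑ j ∈ A, ‖z j‖ ≤ ∑ j ∈ A, (|RCLike.re (z j)| + |RCLike.im (z j)|) :=
        Finset.sum_le_sum fun j _ => by
          calc ‖z j‖ = ‖(RCLike.re (z j) : 𝕜) + RCLike.im (z j) * RCLike.I‖ := by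
                rw [RCLike.re_add_im]
            _ ≤ |RCLike.re (z j)| + |RCLike.im (z j)| * 1 := by
                refine (norm_add_le _ _).trans ?_
                rw [norm_mul, RCLike.norm_ofReal, RCLike.norm_ofReal]
                gcongr
                by_cases hI : (RCLike.I : 𝕜) = 0
                · simp [hI]
                · exact (RCLike.norm_I_of_ne_zero hI).le
            _ = _ := by rw [mul_one]
    _ ≤ 4 * M := by rw [Finset.sum_add_distrib]; linarith

/-- Quasi-greedy bases are unconditional for constant coefficients, in dual form. -/
lemma sum_norm_dual_apply_le (hx : IsBiorthogonalSystem x xs) {C : ℝ} (hC : 1 ≤ C)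
    (hxC : ∀ f, ThresholdSumsLE x xs f (C * ‖f‖)) {A : Finset J} {d : J → 𝕜}
    (hd : ∀ j ∈ A, ‖d j‖ = 1) {φ : StrongDual 𝕜 E} (hφ : ‖φ‖ ≤ 1) :
    ∑ j ∈ A, ‖φ (x j)‖ ≤ 8 * C * ‖∑ j ∈ A, d j • x j‖ := by
  have h : ∑ j ∈ A, ‖φ (d j • x j)‖ ≤ 4 * (2 * C * ‖∑ j ∈ A, d j • x j‖) := by
    refine sum_norm_le_of_forall_subset fun B hB => ?_
    rw [← map_sum]
    exact ((φ.le_opNorm _).trans (mul_le_of_le_one_left (norm_nonneg _) hφ)).trans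
      (norm_sum_subset_le hx hC hxC hB hd)
  calc ∑ j ∈ A, ‖φ (x j)‖ = ∑ j ∈ A, ‖φ (d j • x j)‖ :=
        Finset.sum_congr rfl fun j hj => by rw [map_smul, norm_smul, hd j hj, one_mul]
    _ ≤ _ := by linarith

lemma norm_sum_smul_le_norm_sum_smul (hx : IsBiorthogonalSystem x xs) {C : ℝ} (hC : 1 ≤ C)
    (hxC : ∀ f, ThresholdSumsLE x xs f (C * ‖f‖)) {A : Finset J} {c d : J → 𝕜}
    (hc : ∀ j ∈ A, ‖c j‖ = 1) (hd : ∀ j ∈ A, ‖d j‖ = 1) :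
    ‖∑ j ∈ A, c j • x j‖ ≤ 8 * C * ‖∑ j ∈ A, d j • x j‖ := by
  obtain ⟨φ, hφ, hφx⟩ := exists_dual_vector'' 𝕜 (∑ j ∈ A, c j • x j)
  calc ‖∑ j ∈ A, c j • x j‖ = ‖∑ j ∈ A, φ (c j • x j)‖ := by
        rw [← map_sum, hφx, RCLike.norm_ofReal, abs_norm]
    _ ≤ ∑ j ∈ A, ‖φ (x j)‖ := norm_sum_le_of_le _ fun j hj => by
        rw [map_smul, norm_smul, hc j hj, one_mul]
    _ ≤ _ := sum_norm_dual_apply_le hx hC hxC hd hφ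

end Multipliers

/-! ### Averages over signs in `L₁` -/

section Signs

open Classical in
/-- The choice of signs on the index set given by `B`: `1` on `B`, and `-1` off `B`. -/
noncomputable def signOf (𝕜 : Type*) [RCLike 𝕜] {J : Type*} (B : Finset J) (j : J) : 𝕜 :=
  if j ∈ B then 1 else -1

variable {𝕜 : Type*} [RCLike 𝕜] {J : Type*}

lemma norm_signOf (B : Finset J) (j : J) : ‖signOf 𝕜 B j‖ = 1 := by
  unfold signOf
  split_ifs <;> simp

lemma sum_powerset_insert_signOf [DecidableEq J] {A : Finset J} {k : J} (hk : k ∉ A) (a : J → 𝕜)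
    (Φ : 𝕜 → ℝ) :
    ∑ B ∈ (insert k A).powerset, Φ (∑ j ∈ insert k A, signOf 𝕜 B j * a j)
      = ∑ B ∈ A.powerset, (Φ (∑ j ∈ A, signOf 𝕜 B j * a j + a k)
        + Φ (∑ j ∈ A, signOf 𝕜 B j * a j - a k)) := by
  rw [Finset.sum_powerset_insert hk, ← Finset.sum_add_distrib]
  refine Finset.sum_congr rfl fun B hB => ?_
  have hkB : k ∉ B := fun h => hk (Finset.mem_powerset.1 hB h)
  have h1 : ∑ j ∈ A, signOf 𝕜 (insert k B) j * a j = ∑ j ∈ A, signOf 𝕜 B j * a j := by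
    refine Finset.sum_congr rfl fun j hj => ?_
    have hjk : j ≠ k := fun h => hk (h ▸ hj)
    simp [signOf, hjk]
  rw [Finset.sum_insert hk, Finset.sum_insert hk, h1, add_comm]
  have h2 : signOf 𝕜 B k = -1 := by simp [signOf, hkB]
  have h3 : signOf 𝕜 (insert k B) k = 1 := by simp [signOf]
  rw [h2, h3, one_mul, neg_one_mul, add_comm (a k), add_comm (-a k), sub_eq_add_neg]

lemma norm_add_sq_add_norm_sub_sq (s a : 𝕜) :
    ‖s + a‖ ^ 2 + ‖s - a‖ ^ 2 = 2 * (‖s‖ ^ 2 + ‖a‖ ^ 2) := by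
  have := parallelogram_law_with_norm 𝕜 s a
  nlinarith

lemma norm_add_pow_four_add_norm_sub_pow_four_le (s a : 𝕜) :
    ‖s + a‖ ^ 4 + ‖s - a‖ ^ 4 ≤ 2 * (‖s‖ ^ 4 + 6 * ‖s‖ ^ 2 * ‖a‖ ^ 2 + ‖a‖ ^ 4) := by
  have h1 := norm_add_sq (𝕜 := 𝕜) s a
  have h2 := norm_sub_sq (𝕜 := 𝕜) s a
  have h3 : RCLike.re (inner 𝕜 s a) ^ 2 ≤ (‖s‖ * ‖a‖) ^ 2 :=
    sq_le_sq' (by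
      have := (abs_le.1 ((RCLike.abs_re_le_norm _).trans (norm_inner_le_norm (𝕜 := 𝕜) s a))).1
      linarith)
      ((le_abs_self _).trans ((RCLike.abs_re_le_norm _).trans (norm_inner_le_norm s a)))
  have h4 : ‖s + a‖ ^ 4 = (‖s + a‖ ^ 2) ^ 2 := by ring
  have h5 : ‖s - a‖ ^ 4 = (‖s - a‖ ^ 2) ^ 2 := by ring
  rw [h4, h5, h1, h2]
  nlinarith

lemma sum_powerset_norm_sq (A : Finset J) (a : J → 𝕜) :
    ∑ B ∈ A.powerset, ‖∑ j ∈ A, signOf 𝕜 B j * a j‖ ^ 2 = 2 ^ A.card * ∑ j ∈ A, ‖a j‖ ^ 2 := by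
  classical
  induction A using Finset.induction_on with
  | empty => simp
  | insert k A hk ih =>
    rw [sum_powerset_insert_signOf hk a fun z => ‖z‖ ^ 2]
    simp_rw [norm_add_sq_add_norm_sub_sq]
    rw [← Finset.mul_sum, Finset.sum_add_distrib, ih, Finset.sum_const, Finset.card_powerset,
      Finset.card_insert_of_notMem hk, Finset.sum_insert hk, nsmul_eq_mul]
    push_cast
    ring

lemma sum_powerset_norm_pow_four_le (A : Finset J) (a : J → 𝕜) :
    ∑ B ∈ A.powerset, ‖∑ j ∈ A, signOf 𝕜 B j * a j‖ ^ 4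
      ≤ 2 ^ A.card * (3 * (∑ j ∈ A, ‖a j‖ ^ 2) ^ 2) := by
  classical
  induction A using Finset.induction_on with
  | empty => simp
  | insert k A hk ih =>
    rw [sum_powerset_insert_signOf hk a fun z => ‖z‖ ^ 4]
    refine (Finset.sum_le_sum fun B _ =>
      norm_add_pow_four_add_norm_sub_pow_four_le _ (a k)).trans ?_
    rw [← Finset.mul_sum, Finset.sum_add_distrib, Finset.sum_add_distrib, ← Finset.sum_mul,
      ← Finset.mul_sum, sum_powerset_norm_sq, Finset.sum_const, Finset.card_powerset,
      Finset.card_insert_of_notMem hk, Finset.sum_insert hk, nsmul_eq_mul]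
    push_cast
    have h2 : (0 : ℝ) < 2 ^ A.card := by positivity
    have h4 : 0 ≤ (2 : ℝ) ^ A.card * ‖a k‖ ^ 4 := by positivity
    rw [pow_succ (2 : ℝ)]
    nlinarith

/-- The upper bound in Khintchine's inequality, in the mean of order one. -/
lemma sum_powerset_norm_le (A : Finset J) (a : J → 𝕜) :
    ∑ B ∈ A.powerset, ‖∑ j ∈ A, signOf 𝕜 B j * a j‖
      ≤ 2 ^ A.card * √(∑ j ∈ A, ‖a j‖ ^ 2) := by
  have h := sq_sum_le_card_mul_sum_sq (s := A.powerset)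
    (f := fun B => ‖∑ j ∈ A, signOf 𝕜 B j * a j‖)
  rw [sum_powerset_norm_sq, Finset.card_powerset] at h
  push_cast at h
  refine le_of_sq_le_sq ?_ (by positivity)
  rw [mul_pow, Real.sq_sqrt (Finset.sum_nonneg fun _ _ => by positivity)]
  linarith

/-- The lower bound in Khintchine's inequality, in the mean of order one, from the second and
fourth moments and the inequality `2 u ≥ 3 u² - u⁴` for `u ≥ 0`. -/
lemma le_sum_powerset_norm (A : Finset J) (a : J → 𝕜) :
    2 ^ A.card * (√(∑ j ∈ A, ‖a j‖ ^ 2) / 2)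
      ≤ ∑ B ∈ A.powerset, ‖∑ j ∈ A, signOf 𝕜 B j * a j‖ := by
  set σ := √(∑ j ∈ A, ‖a j‖ ^ 2) with hσ
  have hσ2 : σ ^ 2 = ∑ j ∈ A, ‖a j‖ ^ 2 :=
    Real.sq_sqrt (Finset.sum_nonneg fun _ _ => by positivity)
  have hσ0 : 0 ≤ σ := Real.sqrt_nonneg _
  rcases hσ0.eq_or_lt with h0 | hpos
  · rw [← h0]
    simpa using Finset.sum_nonneg fun _ _ => norm_nonneg _
  -- the inequality for `u / (2 * σ)`
  have hpt : ∀ u : ℝ, 0 ≤ u → 3 / (4 * σ) * u ^ 2 - 1 / (16 * σ ^ 3) * u ^ 4 ≤ u := by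
    intro u hu
    have hv : 0 ≤ u / (2 * σ) := by positivity
    have key : 0 ≤ (u / (2 * σ)) * (1 - u / (2 * σ)) ^ 2 * (u / (2 * σ) + 2) := by positivity
    have : u - (3 / (4 * σ) * u ^ 2 - 1 / (16 * σ ^ 3) * u ^ 4)
        = σ * ((u / (2 * σ)) * (1 - u / (2 * σ)) ^ 2 * (u / (2 * σ) + 2)) := by
      field_simp
      ring
    have h2 := mul_nonneg hpos.le key
    linarith
  have h2 := sum_powerset_norm_sq A a
  have h4 := sum_powerset_norm_pow_four_le A a
  rw [← hσ2] at h2 h4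
  have hpow : (0 : ℝ) < 2 ^ A.card := by positivity
  calc 2 ^ A.card * (σ / 2)
      ≤ 3 / (4 * σ) * (2 ^ A.card * σ ^ 2)
        - 1 / (16 * σ ^ 3) * (2 ^ A.card * (3 * (σ ^ 2) ^ 2)) := by
        have : 3 / (4 * σ) * (2 ^ A.card * σ ^ 2)
            - 1 / (16 * σ ^ 3) * (2 ^ A.card * (3 * (σ ^ 2) ^ 2)) = 2 ^ A.card * (9 / 16 * σ) := by
          field_simp
          ring
        rw [this]
        gcongr
        linarith
    _ ≤ 3 / (4 * σ) * ∑ B ∈ A.powerset, ‖∑ j ∈ A, signOf 𝕜 B j * a j‖ ^ 2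
        - 1 / (16 * σ ^ 3) * ∑ B ∈ A.powerset, ‖∑ j ∈ A, signOf 𝕜 B j * a j‖ ^ 4 := by
        rw [h2]
        gcongr
    _ ≤ _ := by
        rw [Finset.mul_sum, Finset.mul_sum, ← Finset.sum_sub_distrib]
        exact Finset.sum_le_sum fun B _ => hpt _ (norm_nonneg _)

/-- For `0 < q ≤ 2`, the `ℓ₂` norm is at most the `ℓ_q` norm `s`, and `s ≤ l + l ^ (1 - q) * s ^ q`
when `1 ≤ q`. -/
lemma sqrt_sum_sq_le {q l : ℝ} (hq1 : 1 ≤ q) (hq2 : q ≤ 2) (hl : 0 < l) (A : Finset J)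
    (a : J → 𝕜) :
    √(∑ j ∈ A, ‖a j‖ ^ 2) ≤ l + l ^ (1 - q) * ∑ j ∈ A, ‖a j‖ ^ q := by
  set σ := √(∑ j ∈ A, ‖a j‖ ^ 2) with hσ
  have hσ2 : σ ^ 2 = ∑ j ∈ A, ‖a j‖ ^ 2 :=
    Real.sq_sqrt (Finset.sum_nonneg fun _ _ => by positivity)
  have hS : 0 ≤ ∑ j ∈ A, ‖a j‖ ^ q := Finset.sum_nonneg fun _ _ => by positivity
  rcases le_or_gt σ l with h | h
  · have : 0 ≤ l ^ (1 - q) * ∑ j ∈ A, ‖a j‖ ^ q := by positivity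
    linarith
  have hσpos : 0 < σ := hl.trans h
  have hle : ∀ j ∈ A, ‖a j‖ ≤ σ := fun j hj => by
    refine Real.le_sqrt_of_sq_le ?_
    exact Finset.single_le_sum (f := fun j => ‖a j‖ ^ 2) (fun _ _ => by positivity) hj
  have h1 : σ ^ 2 ≤ σ ^ (2 - q) * ∑ j ∈ A, ‖a j‖ ^ q := by
    rw [hσ2, Finset.mul_sum]
    refine Finset.sum_le_sum fun j hj => ?_
    calc ‖a j‖ ^ 2 = ‖a j‖ ^ ((2 - q) + q) := by norm_num
      _ = ‖a j‖ ^ (2 - q) * ‖a j‖ ^ q :=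
        Real.rpow_add_of_nonneg (norm_nonneg _) (by linarith) (by linarith)
      _ ≤ _ := by
        gcongr
        exact hle j hj
  have h2 : σ = σ ^ 2 * σ ^ (-1 : ℝ) := by
    rw [Real.rpow_neg_one]
    field_simp
  calc σ = σ ^ 2 * σ ^ (-1 : ℝ) := h2
    _ ≤ σ ^ (2 - q) * (∑ j ∈ A, ‖a j‖ ^ q) * σ ^ (-1 : ℝ) := by gcongr
    _ = σ ^ (1 - q) * ∑ j ∈ A, ‖a j‖ ^ q := by
      rw [show 1 - q = (2 - q) + -1 by ring, Real.rpow_add hσpos]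
      ring
    _ ≤ l ^ (1 - q) * ∑ j ∈ A, ‖a j‖ ^ q := by
      gcongr ?_ * _
      exact Real.rpow_le_rpow_of_nonpos hl h.le (by linarith)
    _ ≤ _ := by linarith

variable {Ω : Type*} [MeasurableSpace Ω] {μ : Measure Ω}

lemma sum_powerset_norm_eq_integral (A : Finset J) (y : J → Lp 𝕜 1 μ) :
    Integrable (fun ω => ∑ B ∈ A.powerset, ‖∑ j ∈ A, signOf 𝕜 B j * y j ω‖) μ ∧
    ∑ B ∈ A.powerset, ‖∑ j ∈ A, signOf 𝕜 B j • y j‖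
      = ∫ ω, ∑ B ∈ A.powerset, ‖∑ j ∈ A, signOf 𝕜 B j * y j ω‖ ∂μ := by
  have hint : ∀ B ∈ A.powerset, Integrable (fun ω => ‖∑ j ∈ A, signOf 𝕜 B j * y j ω‖) μ :=
    fun B _ => (integrable_finsetSum _ fun j _ =>
      (L1.integrable_coeFn (y j)).const_mul _).norm
  refine ⟨integrable_finsetSum _ hint, ?_⟩
  rw [integral_finsetSum _ hint]
  refine Finset.sum_congr rfl fun B _ => ?_
  rw [L1.norm_eq_integral_norm]
  refine integral_congr_ae ?_
  have h1 := Lp.coeFn_fun_finsetSum A fun j => signOf 𝕜 B j • y j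
  have h2 : ∀ᵐ ω ∂μ, ∀ j ∈ A, (signOf 𝕜 B j • y j : Lp 𝕜 1 μ) ω = signOf 𝕜 B j * y j ω := by
    rw [Finset.eventually_all]
    intro j _
    filter_upwards [Lp.coeFn_smul (signOf 𝕜 B j) (y j)] with ω hω
    rw [hω]; rfl
  filter_upwards [h1, h2] with ω hω1 hω2
  rw [hω1, Finset.sum_congr rfl hω2]

/-- The space `L₁` has cotype two: some choice of signs makes the sum as large as for an orthogonal
family. -/
lemma exists_sum_norm_le_norm_sum_signOf (A : Finset J) (y : J → Lp 𝕜 1 μ) :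
    ∃ B : Finset J, ∑ j ∈ A, ‖y j‖ ≤ 2 * √A.card * ‖∑ j ∈ A, signOf 𝕜 B j • y j‖ := by
  obtain ⟨hi, heq⟩ := sum_powerset_norm_eq_integral A y
  have hpow : (0 : ℝ) < 2 ^ A.card := by positivity
  have hle : 2 ^ A.card * ∑ j ∈ A, ‖y j‖
      ≤ ∑ B ∈ A.powerset, 2 * √A.card * ‖∑ j ∈ A, signOf 𝕜 B j • y j‖ := by
    rw [← Finset.mul_sum, heq]
    simp_rw [L1.norm_eq_integral_norm]
    rw [← integral_finsetSum _ fun j _ => (L1.integrable_coeFn (y j)).norm, ← integral_const_mul,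
      ← integral_const_mul]
    refine integral_mono ((integrable_finsetSum _ fun j _ =>
      (L1.integrable_coeFn (y j)).norm).const_mul _) (hi.const_mul _) fun ω => ?_
    have h1 := le_sum_powerset_norm (𝕜 := 𝕜) A fun j => y j ω
    have h2 : ∑ j ∈ A, ‖y j ω‖ ≤ √A.card * √(∑ j ∈ A, ‖y j ω‖ ^ 2) := by
      rw [← Real.sqrt_mul (by positivity)]
      exact Real.le_sqrt_of_sq_le sq_sum_le_card_mul_sum_sq
    calc 2 ^ A.card * ∑ j ∈ A, ‖y j ω‖ ≤ 2 ^ A.card * (√A.card * √(∑ j ∈ A, ‖y j ω‖ ^ 2)) := by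
          gcongr
      _ = 2 * √A.card * (2 ^ A.card * (√(∑ j ∈ A, ‖y j ω‖ ^ 2) / 2)) := by ring
      _ ≤ _ := by gcongr
  have hcard : 2 ^ A.card * ∑ j ∈ A, ‖y j‖ = ∑ _B ∈ A.powerset, ∑ j ∈ A, ‖y j‖ := by
    rw [Finset.sum_const, Finset.card_powerset, nsmul_eq_mul]
    push_cast
    rfl
  rw [hcard] at hle
  obtain ⟨B, _, hB⟩ := Finset.exists_le_of_sum_le (Finset.powerset_nonempty A) hle
  exact ⟨B, hB⟩

/-- For `1 ≤ q ≤ 2`, a bounded sequence in `L_q` has type `q` when its sums are measured in `L₁` of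
the finite measure `μ`. -/
lemma exists_norm_sum_signOf_le [IsFiniteMeasure μ] {q M : ℝ} (hq1 : 1 ≤ q) (hq2 : q ≤ 2)
    (A : Finset J) (y : J → Lp 𝕜 1 μ) (hint : ∀ j ∈ A, Integrable (fun ω => ‖y j ω‖ ^ q) μ)
    (hM : ∀ j ∈ A, ∫ ω, ‖y j ω‖ ^ q ∂μ ≤ M) :
    ∃ B : Finset J, ‖∑ j ∈ A, signOf 𝕜 B j • y j‖
      ≤ (μ.real Set.univ + M) * (A.card : ℝ) ^ (1 / q) := by
  obtain ⟨hi, heq⟩ := sum_powerset_norm_eq_integral A y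
  rcases A.eq_empty_or_nonempty with rfl | hA
  · refine ⟨∅, ?_⟩
    have : (0 : ℝ) ^ (q⁻¹) = 0 := Real.zero_rpow (by positivity)
    simp [this]
  set l : ℝ := (A.card : ℝ) ^ (1 / q) with hl
  have hcpos : (0 : ℝ) < A.card := by exact_mod_cast hA.card_pos
  have hlpos : 0 < l := by positivity
  have hlq : l ^ (1 - q) * A.card = l := by
    have : (A.card : ℝ) = l ^ q := by
      rw [hl, ← Real.rpow_mul hcpos.le, one_div_mul_cancel (by positivity), Real.rpow_one]
    rw [this, ← Real.rpow_add hlpos, sub_add_cancel, Real.rpow_one]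
  have hle : ∑ B ∈ A.powerset, ‖∑ j ∈ A, signOf 𝕜 B j • y j‖
      ≤ 2 ^ A.card * ((μ.real Set.univ + M) * l) := by
    rw [heq]
    have hi2 : Integrable (fun ω => ∑ j ∈ A, ‖y j ω‖ ^ q) μ := integrable_finsetSum _ hint
    calc ∫ ω, ∑ B ∈ A.powerset, ‖∑ j ∈ A, signOf 𝕜 B j * y j ω‖ ∂μ
        ≤ ∫ ω, 2 ^ A.card * (l + l ^ (1 - q) * ∑ j ∈ A, ‖y j ω‖ ^ q) ∂μ := by
          refine integral_mono hi
            (((integrable_const l).add (hi2.const_mul _)).const_mul _) fun ω => ?_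
          refine (sum_powerset_norm_le A fun j => y j ω).trans ?_
          gcongr
          exact sqrt_sum_sq_le hq1 hq2 hlpos A fun j => y j ω
      _ = 2 ^ A.card * (μ.real Set.univ * l
            + l ^ (1 - q) * ∑ j ∈ A, ∫ ω, ‖y j ω‖ ^ q ∂μ) := by
          rw [integral_const_mul, integral_add (integrable_const l) (hi2.const_mul _),
            integral_const_mul, integral_finsetSum _ hint, integral_const, smul_eq_mul]
      _ ≤ 2 ^ A.card * (μ.real Set.univ * l + l ^ (1 - q) * ∑ j ∈ A, M) := by
          gcongr with j hj
          exact hM j hj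
      _ = 2 ^ A.card * (μ.real Set.univ * l + (l ^ (1 - q) * A.card) * M) := by
          rw [Finset.sum_const, nsmul_eq_mul]; ring
      _ = _ := by rw [hlq]; ring
  have hcard : 2 ^ A.card * ((μ.real Set.univ + M) * l)
      = ∑ _B ∈ A.powerset, (μ.real Set.univ + M) * l := by
    rw [Finset.sum_const, Finset.card_powerset, nsmul_eq_mul]
    push_cast
    rfl
  rw [hcard] at hle
  obtain ⟨B, _, hB⟩ := Finset.exists_le_of_sum_le (Finset.powerset_nonempty A) hle
  exact ⟨B, hB⟩

end Signs

/-! ### Weighted coefficients in `ℓ₂` -/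

section Coefficients

variable {𝕜 : Type*} [RCLike 𝕜] {E : Type*} [NormedAddCommGroup E] [NormedSpace 𝕜 E]
  {J : Type*} {x : J → E} {xs : J → StrongDual 𝕜 E}

/-- If the coefficients of `f` lie in weak `ℓ₂`, then they lie in `ℓ_r` for all `r > 2`. The greedy
ordering serves as the decreasing rearrangement. -/
lemma IsQuasiGreedyBasis.summable_norm_coord_rpow {τ : J ≃ ℕ} (hx : IsQuasiGreedyBasis τ x xs)
    {f : E} {D : ℝ} (hD : ∀ (t : ℝ) (A : Finset J), 0 < t → IsThresholdSet xs f t A →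
      t * √A.card ≤ D) {r : ℝ} (hr : 2 < r) :
    Summable fun j => ‖xs j f‖ ^ r := by
  obtain ⟨K, hK, hxs⟩ := hx.exists_norm_coord_le
  obtain ⟨ρ, hρ, -⟩ := hx.tendsto_greedy f
  have hsupp : ∀ j ∉ Set.range ρ, ‖xs j f‖ ^ r = 0 := by
    intro j hj
    have : xs j f = 0 := by
      by_contra h
      exact hj (hρ.support_subset h)
    rw [this, norm_zero, Real.zero_rpow (by linarith)]
  rw [← hρ.injective.summable_iff hsupp]
  have hpt : ∀ n : ℕ, ‖xs (ρ n) f‖ ≤ |D| * ((n + 1 : ℕ) : ℝ) ^ (-(1 / 2) : ℝ) := by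
    intro n
    rcases (norm_nonneg (xs (ρ n) f)).eq_or_lt with h | h
    · rw [← h]; positivity
    obtain ⟨A, hA⟩ := hx.biorthogonal.exists_isThresholdSet hK hxs f h
    have hsub : (Finset.range (n + 1)).map ⟨ρ, hρ.injective⟩ ⊆ A := by
      intro j hj
      obtain ⟨k, hk, rfl⟩ := Finset.mem_map.1 hj
      exact (hA _).2 (hρ.antitone k n (Nat.lt_succ_iff.1 (Finset.mem_range.1 hk)))
    have hcard : ((n + 1 : ℕ) : ℝ) ≤ A.card := by
      have := Finset.card_le_card hsub
      rw [Finset.card_map, Finset.card_range] at this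
      exact_mod_cast this
    have h1 : ‖xs (ρ n) f‖ * √((n + 1 : ℕ) : ℝ) ≤ |D| :=
      le_trans (by gcongr) ((hD _ A h hA).trans (le_abs_self D))
    rw [Real.rpow_neg (by positivity), ← Real.sqrt_eq_rpow, ← div_eq_mul_inv]
    exact (le_div_iff₀ (Real.sqrt_pos.2 (by positivity))).2 h1
  have hs : Summable fun n : ℕ => |D| ^ r * ((n + 1 : ℕ) : ℝ) ^ (-(r / 2)) := by
    refine Summable.mul_left _ ?_
    exact (summable_nat_add_iff 1).2 (Real.summable_nat_rpow.2 (by linarith))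
  refine hs.of_nonneg_of_le (fun n => Real.rpow_nonneg (norm_nonneg _) _) fun n => ?_
  calc ‖xs (ρ n) f‖ ^ r ≤ (|D| * ((n + 1 : ℕ) : ℝ) ^ (-(1 / 2) : ℝ)) ^ r :=
        Real.rpow_le_rpow (norm_nonneg _) (hpt n) (by linarith)
    _ = _ := by
        rw [Real.mul_rpow (by positivity) (by positivity), ← Real.rpow_mul (by positivity)]
        ring_nf

/-- If every element has coefficients in weak `ℓ₂`, then the coefficients multiplied by the weights
`(n + 1) ^ (-δ)` define a bounded operator into `ℓ₂`. -/
lemma IsQuasiGreedyBasis.exists_weighted_coord_clm [CompleteSpace E] {τ : J ≃ ℕ}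
    (hx : IsQuasiGreedyBasis τ x xs)
    (hD : ∀ f, ∃ D : ℝ, ∀ (t : ℝ) (A : Finset J), 0 < t → IsThresholdSet xs f t A →
      t * √A.card ≤ D) {δ : ℝ} (hδ0 : 0 < δ) (hδ1 : δ < 1) :
    ∃ T : E →L[𝕜] lp (fun _ : ℕ => 𝕜) 2,
      ∀ f n, T f n = (((n + 1 : ℕ) : ℝ) ^ (-δ) : ℝ) * xs (τ.symm n) f := by
  have hmem : ∀ f,
      Memℓp (fun n : ℕ => ((((n + 1 : ℕ) : ℝ) ^ (-δ) : ℝ) : 𝕜) * xs (τ.symm n) f) 2 := by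
    intro f
    obtain ⟨D, hD⟩ := hD f
    have hr : 2 < 2 * (1 / (1 - δ)) := by
      have : 1 < 1 / (1 - δ) := by rw [lt_div_iff₀ (by linarith)]; linarith
      linarith
    have hs1 : Summable fun n : ℕ => ‖xs (τ.symm n) f‖ ^ (2 * (1 / (1 - δ))) :=
      (hx.summable_norm_coord_rpow hD hr).comp_injective τ.symm.injective
    have hs2 : Summable fun n : ℕ => ((n + 1 : ℕ) : ℝ) ^ (-2 : ℝ) :=
      (summable_nat_add_iff 1).2 (Real.summable_nat_rpow.2 (by norm_num))
    have hconj : (1 / δ).HolderConjugate (1 / (1 - δ)) := by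
      rw [Real.holderConjugate_iff]
      refine ⟨by rw [lt_div_iff₀ hδ0]; linarith, by simp⟩
    refine memℓp_gen ((hs2.add hs1).of_nonneg_of_le (fun n => by positivity) fun n => ?_)
    rw [norm_mul, RCLike.norm_ofReal, abs_of_nonneg (by positivity), ENNReal.toReal_ofNat,
      Real.mul_rpow (by positivity) (by positivity), ← Real.rpow_mul (by positivity)]
    -- Young's inequality with exponents `1 / δ` and `1 / (1 - δ)`
    refine (Real.young_inequality_of_nonneg (by positivity) (by positivity) hconj).trans ?_
    rw [← Real.rpow_mul (by positivity), ← Real.rpow_mul (by positivity)]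
    have he : -δ * 2 * (1 / δ) = -2 := by field_simp
    rw [he]
    refine add_le_add (div_le_self (by positivity) hconj.lt.le)
      (div_le_self (by positivity) hconj.symm.lt.le)
  let T : E →ₗ[𝕜] lp (fun _ : ℕ => 𝕜) 2 :=
    { toFun := fun f => ⟨_, hmem f⟩
      map_add' := fun f g => by
        ext n
        simp only [map_add]
        exact mul_add _ _ _
      map_smul' := fun c f => by
        ext n
        simp [mul_left_comm] }
  have hT : ∀ f n, T f n = (((n + 1 : ℕ) : ℝ) ^ (-δ) : ℝ) * xs (τ.symm n) f := fun _ _ => rfl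
  refine ⟨⟨T, T.continuous_of_seq_closed_graph fun u f g hu hTu => ?_⟩, hT⟩
  ext n
  have h1 : Tendsto (fun k => T (u k) n) atTop (𝓝 (g n)) := by
    rw [tendsto_iff_norm_sub_tendsto_zero] at hTu ⊢
    refine squeeze_zero (fun k => norm_nonneg _) (fun k => ?_) hTu
    exact lp.norm_apply_le_norm (by norm_num) (T (u k) - g) n
  have h2 : Tendsto (fun k => T (u k) n) atTop (𝓝 (T f n)) := by
    simp_rw [hT]
    exact (((xs (τ.symm n)).continuous.tendsto f).comp hu).const_mul _
  exact tendsto_nhds_unique h1 h2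

end Coefficients

/-! ### Quasi-greedy bases of subspaces of `L₁` -/

section SubspaceOfL1

variable {𝕜 : Type*} [RCLike 𝕜] {Ω : Type*} [MeasurableSpace Ω] {μ : Measure Ω}
  {X : Submodule 𝕜 (Lp 𝕜 1 μ)} {J : Type*} {x : J → X} {xs : J → StrongDual 𝕜 X}

/-- The coefficients with respect to a quasi-greedy basis of a subspace of `L₁` lie in weak `ℓ₂`. -/
lemma exists_mul_sqrt_card_le [CompleteSpace X] {τ : J ≃ ℕ} (hx : IsQuasiGreedyBasis τ x xs)
    (f : X) : ∃ D : ℝ, ∀ (t : ℝ) (A : Finset J), 0 < t → IsThresholdSet xs f t A →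
      t * √A.card ≤ D := by
  obtain ⟨C, hC, hxC⟩ := hx.exists_thresholdSumsLE_mul_norm
  obtain ⟨c, c', hc, hcx⟩ := hx.semiNormalized
  refine ⟨32 * C ^ 2 / c * ‖f‖, fun t A ht hA => ?_⟩
  rcases A.eq_empty_or_nonempty with rfl | hne
  · simp only [Finset.card_empty, Nat.cast_zero, Real.sqrt_zero, mul_zero]
    positivity
  have hmpos : (0 : ℝ) < A.card := by exact_mod_cast hne.card_pos
  have hsq : √(A.card : ℝ) * √A.card = A.card := Real.mul_self_sqrt hmpos.le
  have hspos : 0 < √(A.card : ℝ) := Real.sqrt_pos.2 hmpos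
  obtain ⟨B, hB⟩ := exists_sum_norm_le_norm_sum_signOf A fun j => (x j : Lp 𝕜 1 μ)
  have hcast : ‖∑ j ∈ A, signOf 𝕜 B j • (x j : Lp 𝕜 1 μ)‖ = ‖∑ j ∈ A, signOf 𝕜 B j • x j‖ := by
    rw [Submodule.coe_norm]
    push_cast
    rfl
  rw [hcast] at hB
  have h1 : c * A.card ≤ ∑ j ∈ A, ‖(x j : Lp 𝕜 1 μ)‖ := by
    calc c * A.card = ∑ j ∈ A, c := by rw [Finset.sum_const, nsmul_eq_mul, mul_comm]
      _ ≤ _ := Finset.sum_le_sum fun j _ => (hcx j).1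
  have h2 : ‖∑ j ∈ A, signOf 𝕜 B j • x j‖
      ≤ 8 * C * ‖∑ j ∈ A, (xs j f / (‖xs j f‖ : 𝕜)) • x j‖ := by
    refine norm_sum_smul_le_norm_sum_smul hx.biorthogonal hC hxC
      (fun j _ => norm_signOf B j) fun j hj => ?_
    have : 0 < ‖xs j f‖ := ht.trans_le ((hA j).1 hj)
    rw [norm_div, RCLike.norm_ofReal, abs_norm, div_self this.ne']
  have h3 := mul_norm_sum_sign_le (by linarith) hxC ht hA
  have h4 : c * (t * √A.card) * √A.card ≤ 32 * C ^ 2 * ‖f‖ * √A.card := by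
    calc c * (t * √A.card) * √A.card = t * (c * A.card) := by
          linear_combination c * t * hsq
      _ ≤ t * (2 * √A.card * (8 * C * ‖∑ j ∈ A, (xs j f / (‖xs j f‖ : 𝕜)) • x j‖)) := by
        exact mul_le_mul_of_nonneg_left
          (h1.trans (hB.trans (mul_le_mul_of_nonneg_left h2 (by positivity)))) ht.le
      _ = 16 * C * √A.card * (t * ‖∑ j ∈ A, (xs j f / (‖xs j f‖ : 𝕜)) • x j‖) := by ring
      _ ≤ 16 * C * √A.card * (2 * (C * ‖f‖)) := by gcongr
      _ = _ := by ring
  have h5 := le_of_mul_le_mul_right h4 hspos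
  rw [div_mul_eq_mul_div, le_div_iff₀ hc]
  linarith

/-- A bound for `‖x j‖_q` near infinity yields, for some exponent `1 < r ≤ 2`, a bound for the
integrals of `‖x j‖ ^ r`. -/
lemma exists_integral_rpow_le_of_limsup_ne_top [IsFiniteMeasure μ] {q : ℝ≥0∞} (hq : 1 < q)
    {y : J → Lp 𝕜 1 μ} (h : limsup (fun j => eLpNorm (y j) q μ) cofinite ≠ ⊤) :
    ∃ r M : ℝ, 1 < r ∧ r ≤ 2 ∧ ∀ᶠ j in cofinite,
      Integrable (fun ω => ‖y j ω‖ ^ r) μ ∧ ∫ ω, ‖y j ω‖ ^ r ∂μ ≤ M := by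
  obtain ⟨b, hb, hbtop⟩ := exists_between h.lt_top
  set p : ℝ≥0∞ := min q 2 with hp
  have hp1 : 1 < p := lt_min hq ENNReal.one_lt_two
  have hptop : p ≠ ⊤ := ((min_le_right q 2).trans_lt ENNReal.ofNat_lt_top).ne
  have hp0 : p ≠ 0 := (zero_lt_one.trans hp1).ne'
  have hr1 : 1 < p.toReal := by
    rw [← ENNReal.toReal_one]
    exact (ENNReal.toReal_lt_toReal ENNReal.one_ne_top hptop).2 hp1
  have hr2 : p.toReal ≤ 2 := by
    have := ENNReal.toReal_mono ENNReal.ofNat_ne_top (min_le_right q 2)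
    simpa using this
  set m : ℝ≥0∞ := b * μ Set.univ ^ (1 / p.toReal - 1 / q.toReal) with hm
  have hpq : 0 ≤ 1 / p.toReal - 1 / q.toReal := by
    rcases eq_or_ne q ⊤ with rfl | hqtop
    · simp
    · rw [sub_nonneg]
      exact one_div_le_one_div_of_le (by linarith) (ENNReal.toReal_mono hqtop (min_le_left q 2))
  have hmtop : m ≠ ⊤ :=
    ENNReal.mul_ne_top hbtop.ne (ENNReal.rpow_ne_top_of_nonneg hpq (measure_ne_top μ _))
  refine ⟨p.toReal, m.toReal ^ p.toReal, hr1, hr2, ?_⟩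
  filter_upwards [eventually_lt_of_limsup_lt hb] with j hj
  have hmeas : AEStronglyMeasurable (y j) μ := Lp.aestronglyMeasurable (y j)
  have hle : eLpNorm (y j) p μ ≤ m :=
    (eLpNorm_le_eLpNorm_mul_rpow_measure_univ (min_le_left q 2) hmeas).trans (by rw [hm]; gcongr)
  have hmem : MemLp (y j) p μ := ⟨hmeas, hle.trans_lt hmtop.lt_top⟩
  refine ⟨hmem.integrable_norm_rpow hp0 hptop, ?_⟩
  have hnn : 0 ≤ ∫ ω, ‖y j ω‖ ^ p.toReal ∂μ := integral_nonneg fun ω => by positivity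
  rw [hmem.eLpNorm_eq_integral_rpow_norm hp0 hptop,
    ENNReal.ofReal_le_iff_le_toReal hmtop] at hle
  exact (Real.rpow_inv_le_iff_of_pos hnn ENNReal.toReal_nonneg (by linarith)).1 hle

end SubspaceOfL1

end QuasiGreedy

open QuasiGreedy

theorem mainTheorem4 {𝕜 : Type*} [RCLike 𝕜] {Ω : Type*} [MeasurableSpace Ω]
    (μ : Measure Ω) [IsFiniteMeasure μ]
    (X : Submodule 𝕜 (Lp 𝕜 1 μ)) (hX : IsClosed (X : Set (Lp 𝕜 1 μ)))
    (hGT : QuasiGreedy.IsGTSpace 𝕜 X)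
    {J : Type*} (τ : J ≃ ℕ) (x : J → X) (xs : J → StrongDual 𝕜 X)
    (hx : QuasiGreedy.IsQuasiGreedyBasis τ x xs)
    (q : ℝ≥0∞) (hq : 1 < q) :
    limsup (fun j => eLpNorm ((x j : Lp 𝕜 1 μ) : Ω → 𝕜) q μ) cofinite = ⊤ := by
  by_contra hne
  have : CompleteSpace X := hX.completeSpace_coe
  obtain ⟨r, M, hr1, hr2, hM⟩ := exists_integral_rpow_le_of_limsup_ne_top hq hne
  -- all indices of rank at least `a` satisfy the bound
  obtain ⟨a, ha⟩ : ∃ a : ℕ, ∀ n ≥ a, Integrable (fun ω => ‖(x (τ.symm n) : Lp 𝕜 1 μ) ω‖ ^ r) μ ∧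
      ∫ ω, ‖(x (τ.symm n) : Lp 𝕜 1 μ) ω‖ ^ r ∂μ ≤ M := by
    have := τ.symm.injective.tendsto_cofinite.eventually hM
    rw [Nat.cofinite_eq_atTop] at this
    exact eventually_atTop.1 this
  obtain ⟨C, hC, hxC⟩ := hx.exists_thresholdSumsLE_mul_norm
  have hr : 1 / r < 1 := by rw [div_lt_one (by linarith)]; exact hr1
  have hr0 : 0 < 1 / r := by positivity
  set δ : ℝ := (1 - 1 / r) / 2 with hδ
  have hδ0 : 0 < δ := by rw [hδ]; linarith
  have hδ1 : δ < 1 := by rw [hδ]; linarith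
  obtain ⟨T, hT⟩ := hx.exists_weighted_coord_clm (exists_mul_sqrt_card_le hx) hδ0 hδ1
  obtain ⟨K, hK, hTK⟩ := hGT T
  set R : ℝ := K * (8 * C * (μ.real Set.univ + M)) with hR
  have key : ∀ N : ℕ, (N : ℝ) * ((a + N : ℕ) : ℝ) ^ (-δ) ≤ R * (N : ℝ) ^ (1 / r) := by
    intro N
    let e : ℕ ↪ J := ⟨fun i => τ.symm (a + i), fun i k h => by simpa using h⟩
    obtain ⟨B, hB⟩ := exists_norm_sum_signOf_le (μ := μ) hr1.le hr2 ((Finset.range N).map e)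
      (fun j => (x j : Lp 𝕜 1 μ))
      (fun j hj => by
        obtain ⟨i, -, rfl⟩ := Finset.mem_map.1 hj
        exact (ha (a + i) (Nat.le_add_right a i)).1)
      (fun j hj => by
        obtain ⟨i, -, rfl⟩ := Finset.mem_map.1 hj
        exact (ha (a + i) (Nat.le_add_right a i)).2)
    rw [Finset.card_map, Finset.card_range] at hB
    have hcast : ‖∑ j ∈ (Finset.range N).map e, signOf 𝕜 B j • (x j : Lp 𝕜 1 μ)‖
        = ‖∑ j ∈ (Finset.range N).map e, signOf 𝕜 B j • x j‖ := by
      rw [Submodule.coe_norm]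
      push_cast
      rfl
    rw [hcast] at hB
    have hGTN := hTK N (fun i => x (e i))
        (8 * C * ((μ.real Set.univ + M) * (N : ℝ) ^ (1 / r))) (by
      intro φ hφ
      calc ∑ i : Fin N, ‖φ (x (e i))‖ = ∑ j ∈ (Finset.range N).map e, ‖φ (x j)‖ := by
            rw [Finset.sum_map, Finset.sum_range]
        _ ≤ 8 * C * ‖∑ j ∈ (Finset.range N).map e, signOf 𝕜 B j • x j‖ :=
            sum_norm_dual_apply_le hx.biorthogonal hC hxC (fun j _ => norm_signOf B j) hφ
        _ ≤ _ := by gcongr)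
    calc (N : ℝ) * ((a + N : ℕ) : ℝ) ^ (-δ) = ∑ i : Fin N, ((a + N : ℕ) : ℝ) ^ (-δ) := by
          simp
      _ ≤ ∑ i : Fin N, ‖T (x (e i))‖ := by
          refine Finset.sum_le_sum fun i _ => ?_
          have h1 := lp.norm_apply_le_norm (by norm_num) (T (x (e i))) (a + i)
          have h2 : xs (τ.symm (a + i)) (x (e i)) = 1 := hx.biorthogonal.apply_self _
          rw [hT, h2, mul_one, RCLike.norm_ofReal, abs_of_nonneg (by positivity)] at h1
          refine le_trans (Real.rpow_le_rpow_of_nonpos (by positivity) ?_ (by linarith)) h1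
          have := i.2
          exact_mod_cast (by omega : a + (i : ℕ) + 1 ≤ a + N)
      _ ≤ K * (8 * C * ((μ.real Set.univ + M) * (N : ℝ) ^ (1 / r))) := hGTN
      _ = R * (N : ℝ) ^ (1 / r) := by rw [hR]; ring
  -- for `N ≥ a` the bound reads `N ^ δ ≤ R * 2 ^ δ`, as `1 - δ - 1 / r = δ`
  have hbig : ∀ᶠ N : ℕ in atTop, (N : ℝ) ^ δ ≤ R * 2 ^ δ := by
    filter_upwards [eventually_ge_atTop a, eventually_ge_atTop 1] with N hNa hN1
    have hN : (0 : ℝ) < N := by exact_mod_cast hN1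
    have h1 : (2 * N : ℝ) ^ (-δ) ≤ ((a + N : ℕ) : ℝ) ^ (-δ) := by
      refine Real.rpow_le_rpow_of_nonpos (by positivity) ?_ (by linarith)
      exact_mod_cast (by omega : a + N ≤ 2 * N)
    have h2 : (N : ℝ) * (2 * N : ℝ) ^ (-δ) ≤ R * (N : ℝ) ^ (1 / r) :=
      (mul_le_mul_of_nonneg_left h1 hN.le).trans (key N)
    have h3 : (N : ℝ) * (2 * N : ℝ) ^ (-δ) = (N : ℝ) ^ δ * (N : ℝ) ^ (1 / r) * (2 ^ δ)⁻¹ := by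
      have : (N : ℝ) = N ^ δ * (N : ℝ) ^ (1 / r) * (N : ℝ) ^ δ := by
        rw [← Real.rpow_add hN, ← Real.rpow_add hN,
          show δ + 1 / r + δ = 1 by rw [hδ]; ring, Real.rpow_one]
      rw [Real.mul_rpow (by norm_num) hN.le, Real.rpow_neg (by norm_num), Real.rpow_neg hN.le]
      have hNδ : 0 < (N : ℝ) ^ δ := by positivity
      nth_rewrite 1 [this]
      field_simp
    rw [h3, ← div_eq_mul_inv, div_le_iff₀ (by positivity)] at h2
    refine le_of_mul_le_mul_right (a := (N : ℝ) ^ (1 / r)) ?_ (by positivity)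
    linarith
  have hlim : Tendsto (fun N : ℕ => (N : ℝ) ^ δ) atTop atTop :=
    (tendsto_rpow_atTop hδ0).comp tendsto_natCast_atTop_atTop
  obtain ⟨N, h1, h2⟩ := (hbig.and (hlim.eventually_gt_atTop (R * 2 ^ δ))).exists
  exact absurd h1 (not_le.2 h2)
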